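/- Let $\phi:\mathbb{R}\to\mathbb{C}$ be Riemann's non-differentiable function \[ \phi(t) = \sum_{k\in\mathbb{Z}} \frac{e^{-4\pi^2 i k^2 t}-1}{-4\pi^2 k^2}, \] where the term $k=0$ is understood as its limiting value $it$. For $p,q\in\mathbb{N}$ with $q\neq 0$ let $t_{p,q} = \frac{1}{2\pi}\,\frac{p}{q}$. Then for every $M>0$ there exists a constant $C_M>0$, independent of $p$ and $q$, such that for all $p,q\in\mathbb{N}$ with $\gcd(p,q)=1$ and $q\equiv 2 \pmod 4$, \[ |\phi(t_{p,q}+h)-\phi(t_{p,q})| \le C_M\, q^{3/2}\,|h|^{3/2} \qquad \text{for all } h\in\mathbb{R} \text{ with } |h|\le \frac{M}{q^2}. \] -/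

import Mathlib

/-- The `k`-th term of the series of Riemann's non-differentiable function,
`(exp (-4π² i k² t) - 1) / (-4π² k²)`. For `k = 0` the quotient is understood as its limit
when `k → 0`, namely `i t`. -/
noncomputable def riemannTerm (t : ℝ) (k : ℤ) : ℂ :=
  if k = 0 then Complex.I * t
  else (Complex.exp (-4 * Real.pi ^ 2 * Complex.I * k ^ 2 * t) - 1) / (-4 * Real.pi ^ 2 * k ^ 2)

/-- The series of Riemann's function converges absolutely at every real `t`. -/
theorem summable_riemannTerm (t : ℝ) : Summable (riemannTerm t) := by
  have hs : Summable (fun k : ℤ => 1 / (k : ℝ) ^ 2) :=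
    Real.summable_one_div_int_pow.2 one_lt_two
  refine Summable.of_norm_bounded_eventually (hs.mul_left 2) ?_
  refine (Set.finite_singleton (0 : ℤ)).subset ?_
  intro k hk
  by_contra h0
  have hk0 : k ≠ 0 := h0
  refine hk ?_
  change ‖riemannTerm t k‖ ≤ 2 * (1 / (k : ℝ) ^ 2)
  have hkr : (0 : ℝ) < (k : ℝ) ^ 2 := by positivity
  have hexp : ‖Complex.exp (-4 * Real.pi ^ 2 * Complex.I * k ^ 2 * t)‖ = 1 := by
    have : (-4 * Real.pi ^ 2 * Complex.I * k ^ 2 * t : ℂ)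
        = ((-4 * Real.pi ^ 2 * k ^ 2 * t : ℝ) : ℂ) * Complex.I := by push_cast; ring
    rw [this, Complex.norm_exp_ofReal_mul_I]
  have hden : ‖(-4 * Real.pi ^ 2 * k ^ 2 : ℂ)‖ = 4 * Real.pi ^ 2 * (k : ℝ) ^ 2 := by
    have : (-4 * Real.pi ^ 2 * k ^ 2 : ℂ) = ((-(4 * Real.pi ^ 2 * k ^ 2) : ℝ) : ℂ) := by
      push_cast; ring
    rw [this, Complex.norm_real, norm_neg, Real.norm_of_nonneg (by positivity)]
  rw [riemannTerm, if_neg hk0, norm_div, hden, mul_one_div]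
  have hpi : (1 : ℝ) ≤ 4 * Real.pi ^ 2 := by nlinarith [Real.pi_gt_three]
  refine div_le_div₀ zero_le_two ?_ hkr (by nlinarith)
  refine (norm_sub_le _ _).trans ?_
  rw [hexp, norm_one]
  norm_num

/-- Riemann's non-differentiable function
`φ(t) = ∑_{k ∈ ℤ} (exp (-4π² i k² t) - 1) / (-4π² k²)`, a function from `ℝ` to `ℂ`. -/
noncomputable def riemannPhi (t : ℝ) : ℂ := ∑' k : ℤ, riemannTerm t k

/-- The point `t_{p,q} = (p / q) / (2π)`. -/
noncomputable def ratPoint (p q : ℕ) : ℝ := ((p : ℝ) / q) / (2 * Real.pi)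

/-!
Write `e(y) = exp (2πiy)` and `F(x) = (exp (-4π² i x² h) - 1) / (-4π² x²)`. The increment of
Riemann's function at `ratPoint p q` is `∑ₖ e(-p k² / q) F(k)`. Its coefficients are `q`-periodic,
and Poisson summation turns it into a series over `m` whose coefficients are the Gauss sums
`quadGaussSum p m`. The decay of the dual series comes from the oscillation of
`∫₀ʰ s^{-1/2} exp (i m² / (4 q² s)) ds`, which is `O(q² |h|^{3/2} / m²)`. The term `m = 0`, which
would contribute order `|h|^{1/2}`, is absent when `q ≡ 2 (mod 4)`, because then its Gauss sum
vanishes (`quadGaussSum_zero_of_mod_four_eq_two`). With `|quadGaussSum p m| ≤ √(2q)`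
(`norm_quadGaussSum_le`) and the factor `1 / q` of Poisson summation along residue classes modulo
`q`, the remaining terms add up to `O(q^{3/2} |h|^{3/2})`. This argument needs no restriction on
the size of `h`.

To avoid conditionally convergent sums and integrals, the `k`-th term is damped by
`exp (-4π² ε k²)` with `ε > 0`. The damped increment is the integral of a twisted theta function
over the segment from `ε` to `ε + ih` in the right half-plane
(`tsum_mul_riemannTerm_eq_integral`). There the theta function obeys the transformation formula
`tsum_stdAddChar_mul_gaussian`, sum and integral may be exchanged, and one integration by parts
(`norm_integral_vertLine_le`) bounds the `m`-th term uniformly in `ε`. Letting `ε → 0` gives the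
bound for the increment itself (`norm_riemannPhi_ratPoint_add_sub_le`).
-/

/-! ### Quadratic Gauss sums -/

/-- The quadratic Gauss sum `∑ e((-p x² + m x) / q)` over the residues `x` modulo `q`, where
`e(y) = exp (2πiy)`. -/
noncomputable def quadGaussSum {q : ℕ} [NeZero q] (p m : ZMod q) : ℂ :=
  ∑ x : ZMod q, ZMod.stdAddChar (-(p * x ^ 2) + m * x)

/-- Squaring the sum and substituting `x ↦ x + d` in one of the factors leaves the complete linear
sums `∑ₓ e(-2pdx / q)`, which vanish unless `q ∣ 2d`; at most two values of `d` survive. -/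
theorem norm_quadGaussSum_sq_le {q : ℕ} [NeZero q] {p : ZMod q} (hp : IsUnit p) (m : ZMod q) :
    ‖quadGaussSum p m‖ ^ 2 ≤ 2 * q := by
  classical
  set ψ : AddChar (ZMod q) ℂ := ZMod.stdAddChar with hψ
  have h1 : ((‖quadGaussSum p m‖ ^ 2 : ℝ) : ℂ)
      = ∑ d : ZMod q, ψ (-(p * d ^ 2) + m * d) * ∑ x : ZMod q, ψ (x * (-(2 * p * d))) := by
    rw [Complex.ofReal_pow, ← Complex.mul_conj', quadGaussSum, map_sum, Finset.sum_mul_sum,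
      Finset.sum_comm]
    simp_rw [Finset.mul_sum]
    rw [Finset.sum_comm (γ := ZMod q) (s := Finset.univ) (t := Finset.univ)
      (f := fun d x => ψ (-(p * d ^ 2) + m * d) * ψ (x * (-(2 * p * d))))]
    refine Finset.sum_congr rfl fun x _ => ?_
    rw [← Equiv.sum_comp (Equiv.addRight x)]
    refine Finset.sum_congr rfl fun d _ => ?_
    rw [← AddChar.map_neg_eq_conj, ← AddChar.map_add_eq_mul, ← AddChar.map_add_eq_mul]
    congr 1
    simp only [Equiv.coe_addRight]
    ring
  have h2 : ‖quadGaussSum p m‖ ^ 2 ≤ ∑ d : ZMod q, if 2 * d = 0 then (q : ℝ) else 0 := by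
    have : ‖quadGaussSum p m‖ ^ 2 = ‖((‖quadGaussSum p m‖ ^ 2 : ℝ) : ℂ)‖ := by
      rw [Complex.norm_real, Real.norm_of_nonneg (by positivity)]
    rw [this, h1]
    refine (norm_sum_le _ _).trans (Finset.sum_le_sum fun d _ => ?_)
    rw [norm_mul, AddChar.norm_apply, one_mul,
      AddChar.sum_mulShift _ (ZMod.isPrimitive_stdAddChar q)]
    have : -(2 * p * d) = 0 ↔ 2 * d = 0 := by
      rw [neg_eq_zero, mul_comm 2 p, mul_assoc, hp.mul_right_eq_zero]
    simp only [this]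
    split_ifs <;> simp [ZMod.card]
  refine h2.trans ?_
  rw [← Finset.sum_filter, Finset.sum_const, nsmul_eq_mul]
  gcongr
  -- a residue `d` with `2d = 0` has `q ∣ 2 d.val < 2q`, so `d.val` is `0` or `q / 2`
  have hsub : (Finset.univ.filter fun d : ZMod q => 2 * d = 0)
      ⊆ {0, ((q / 2 : ℕ) : ZMod q)} := by
    intro d hd
    have hd : 2 * d = 0 := by simpa using hd
    have hdv : q ∣ 2 * d.val := by
      rw [← ZMod.natCast_eq_zero_iff]; simpa using hd
    obtain ⟨c, hc⟩ := hdv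
    have hlt := ZMod.val_lt d
    have hc2 : c < 2 := by
      by_contra h
      have : q * 2 ≤ q * c := Nat.mul_le_mul_left q (by omega)
      omega
    rw [Finset.mem_insert, Finset.mem_singleton]
    interval_cases c
    · left; rw [← ZMod.val_eq_zero]; omega
    · right; rw [← ZMod.natCast_zmod_val d]; congr 1; omega
  exact_mod_cast (Finset.card_le_card hsub).trans Finset.card_le_two

theorem norm_quadGaussSum_le {q : ℕ} [NeZero q] {p : ZMod q} (hp : IsUnit p) (m : ZMod q) :
    ‖quadGaussSum p m‖ ≤ √(2 * q) :=
  Real.le_sqrt_of_sq_le (norm_quadGaussSum_sq_le hp m)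

/-- For `q = 2n` with `n` and `p` odd the translation `x ↦ x + n` changes the sign of
`e(-p x² / q)`, so the Gauss sum without a linear term vanishes. -/
theorem quadGaussSum_zero_of_mod_four_eq_two {q : ℕ} [NeZero q] (hq : q % 4 = 2) {p : ℕ}
    (hp : Odd p) : quadGaussSum (p : ZMod q) 0 = 0 := by
  obtain ⟨n, rfl⟩ : ∃ n, q = 2 * n := ⟨q / 2, by omega⟩
  set ψ : AddChar (ZMod (2 * n)) ℂ := ZMod.stdAddChar with hψ
  have h2n : (2 : ZMod (2 * n)) * n = 0 := by
    have := ZMod.natCast_self (2 * n)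
    push_cast at this
    exact this
  -- `p n² ≡ n` modulo `2n`, since `p n` is odd
  have hpn : (p : ZMod (2 * n)) * n ^ 2 = n := by
    obtain ⟨b, hb⟩ : Odd (p * n) := hp.mul (Nat.odd_iff.2 (by omega))
    have hb' : (p : ZMod (2 * n)) * n = 2 * b + 1 := by exact_mod_cast congrArg _ hb
    linear_combination (n : ZMod (2 * n)) * hb' + (b : ZMod (2 * n)) * h2n
  have hψn : ψ (-(n : ZMod (2 * n))) = -1 := by
    have hsq : ψ (-(n : ZMod (2 * n))) ^ 2 = 1 := by
      rw [← AddChar.map_nsmul_eq_pow, nsmul_eq_mul]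
      have : ((2 : ℕ) : ZMod (2 * n)) * -(n : ZMod (2 * n)) = 0 := by
        push_cast; linear_combination -h2n
      rw [this, AddChar.map_zero_eq_one]
    refine (eq_or_eq_neg_of_sq_eq_sq _ 1 (by rw [hsq, one_pow])).resolve_left ?_
    intro h1
    rw [← AddChar.map_zero_eq_one ψ] at h1
    have := ZMod.injective_stdAddChar h1
    rw [neg_eq_zero, ZMod.natCast_eq_zero_iff] at this
    have := Nat.le_of_dvd (by omega) this
    omega
  have hS : quadGaussSum (p : ZMod (2 * n)) 0 = -quadGaussSum (p : ZMod (2 * n)) 0 := by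
    conv_lhs => rw [quadGaussSum, ← Equiv.sum_comp (Equiv.addRight (n : ZMod (2 * n)))]
    rw [quadGaussSum, ← Finset.sum_neg_distrib]
    refine Finset.sum_congr rfl fun x _ => ?_
    rw [← hψ, neg_eq_neg_one_mul (ψ _), ← hψn, ← AddChar.map_add_eq_mul]
    congr 1
    simp only [Equiv.coe_addRight]
    linear_combination -hpn - (p : ZMod (2 * n)) * x * h2n
  exact self_eq_neg.1 hS

/-! ### A twisted theta function and its transformation formula -/

theorem norm_cexp_neg_pi_mul_mul_sq (a : ℂ) (x : ℝ) :
    ‖Complex.exp (-Real.pi * a * x ^ 2)‖ = Real.exp (-Real.pi * a.re * x ^ 2) := by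
  rw [Complex.norm_exp]
  congr 1
  have : (-Real.pi * a * x ^ 2 : ℂ) = ((-Real.pi * x ^ 2 : ℝ) : ℂ) * a := by push_cast; ring
  rw [this, Complex.re_ofReal_mul]
  ring

theorem summable_exp_neg_pi_mul_mul_sq {c : ℝ} (hc : 0 < c) :
    Summable fun k : ℤ => Real.exp (-Real.pi * c * (k : ℝ) ^ 2) := by
  have hs : Summable (fun k : ℤ => 1 / (k : ℝ) ^ 2) :=
    Real.summable_one_div_int_pow.2 one_lt_two
  refine Summable.of_norm_bounded_eventually (hs.mul_left (1 / (Real.pi * c))) ?_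
  refine (Set.finite_singleton (0 : ℤ)).subset fun k hk => ?_
  by_contra h0
  have hk0 : k ≠ 0 := h0
  refine hk ?_
  change ‖Real.exp (-Real.pi * c * (k : ℝ) ^ 2)‖ ≤ 1 / (Real.pi * c) * (1 / (k : ℝ) ^ 2)
  have hx : 0 < Real.pi * c * (k : ℝ) ^ 2 := by positivity
  rw [Real.norm_of_nonneg (Real.exp_pos _).le, one_div_mul_one_div, neg_mul, neg_mul, Real.exp_neg,
    ← one_div]
  exact one_div_le_one_div_of_le hx (by linarith [Real.add_one_le_exp (Real.pi * c * (k : ℝ) ^ 2)])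

theorem tsum_int_eq_sum_zmod {q : ℕ} [NeZero q] {f : ℤ → ℂ} (hf : Summable f) :
    ∑' k : ℤ, f k = ∑ r : ZMod q, ∑' j : ℤ, f (j * q + r.val) := by
  obtain ⟨n, rfl⟩ := Nat.exists_eq_succ_of_ne_zero (NeZero.ne q)
  have hg := (Int.divModEquiv (n + 1)).symm.summable_iff.2 hf
  rw [← (Int.divModEquiv (n + 1)).symm.tsum_eq]
  have hsw : Summable fun x : Fin (n + 1) × ℤ => f (x.2 * (n + 1 : ℕ) + (x.1 : ℕ)) :=
    (Equiv.prodComm (Fin (n + 1)) ℤ).summable_iff.2 hg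
  rw [← (Equiv.prodComm (Fin (n + 1)) ℤ).tsum_eq]
  exact hsw.tsum_prod.trans (tsum_fintype _)

theorem stdAddChar_mul_zmod_val {q : ℕ} [NeZero q] (m : ℤ) (r : ZMod q) :
    (ZMod.stdAddChar ((m : ZMod q) * r) : ℂ)
      = Complex.exp (2 * Real.pi * Complex.I * m * r.val / q) := by
  have : (m : ZMod q) * r = ((m * r.val : ℤ) : ZMod q) := by simp
  rw [this, ZMod.stdAddChar_coe]
  congr 1
  push_cast
  ring

/-- Poisson summation along the residue class `r + qℤ` for a Gaussian of width `q`. -/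
theorem tsum_gaussian_residue_class {q : ℕ} [NeZero q] {a : ℂ} (ha : 0 < a.re) (r : ZMod q) :
    ∑' j : ℤ, Complex.exp (-Real.pi * a * (((j * q + r.val : ℤ) : ℂ) / q) ^ 2)
      = 1 / a ^ (1 / 2 : ℂ) * ∑' m : ℤ, ZMod.stdAddChar ((m : ZMod q) * r) *
          Complex.exp (-Real.pi / a * m ^ 2) := by
  have hq : (q : ℂ) ≠ 0 := Nat.cast_ne_zero.2 (NeZero.ne q)
  have ha0 : a ≠ 0 := by rintro rfl; simp at ha
  have key := Complex.tsum_exp_neg_quadratic ha (-a * (r.val / q))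
  have hl : ∀ j : ℤ, Complex.exp (-Real.pi * a * (((j * q + r.val : ℤ) : ℂ) / q) ^ 2)
      = Complex.exp (-Real.pi * a * (r.val / q) ^ 2) *
        Complex.exp (-Real.pi * a * j ^ 2 + 2 * Real.pi * (-a * (r.val / q)) * j) := by
    intro j
    rw [← Complex.exp_add]
    congr 1
    push_cast
    field_simp
    ring
  have hr : ∀ m : ℤ, Complex.exp (-Real.pi * a * (r.val / q) ^ 2) *
        Complex.exp (-Real.pi / a * (m + Complex.I * (-a * (r.val / q))) ^ 2)
      = ZMod.stdAddChar ((m : ZMod q) * r) * Complex.exp (-Real.pi / a * m ^ 2) := by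
    intro m
    rw [stdAddChar_mul_zmod_val, ← Complex.exp_add, ← Complex.exp_add]
    congr 1
    field_simp
    ring_nf
    rw [Complex.I_sq]
    ring
  simp_rw [hl, ← hr]
  rw [tsum_mul_left, tsum_mul_left, key]
  ring

theorem div_re_pos {a : ℂ} (ha : 0 < a.re) : 0 < (1 / a).re := by
  have ha0 : a ≠ 0 := by rintro rfl; simp at ha
  rw [one_div, Complex.inv_re]
  exact div_pos ha (Complex.normSq_pos.2 ha0)

theorem summable_cexp_neg_pi_mul_mul_sq {a : ℂ} (ha : 0 < a.re) :
    Summable fun m : ℤ => Complex.exp (-Real.pi * a * m ^ 2) := by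
  refine Summable.of_norm ?_
  simpa using (summable_exp_neg_pi_mul_mul_sq ha).congr
    fun m => (norm_cexp_neg_pi_mul_mul_sq a m).symm

theorem summable_bounded_mul {c f : ℤ → ℂ} {B : ℝ} (hc : ∀ k, ‖c k‖ ≤ B)
    (hf : Summable fun k => ‖f k‖) : Summable fun k => c k * f k :=
  Summable.of_norm_bounded (hf.mul_left B) fun k => by
    rw [norm_mul]
    exact mul_le_mul_of_nonneg_right (hc k) (norm_nonneg _)

/-- The transformation formula of the theta function twisted by the `q`-periodic coefficients
`e(-p k² / q)`. The dual coefficients are the Gauss sums `quadGaussSum p m`. -/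
theorem tsum_stdAddChar_mul_gaussian {q : ℕ} [NeZero q] (p : ZMod q) {a : ℂ} (ha : 0 < a.re) :
    ∑' k : ℤ, ZMod.stdAddChar (-(p * (k : ZMod q) ^ 2)) *
        Complex.exp (-Real.pi * a * ((k : ℂ) / q) ^ 2)
      = 1 / a ^ (1 / 2 : ℂ) *
        ∑' m : ℤ, quadGaussSum p (m : ZMod q) * Complex.exp (-Real.pi / a * m ^ 2) := by
  have hq : (0 : ℝ) < q := Nat.cast_pos.2 (NeZero.pos q)
  have hq2 : ((q : ℂ) ^ 2)⁻¹ = (((q : ℝ) ^ 2)⁻¹ : ℝ) := by push_cast; rfl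
  have ha' : 0 < (a * ((q : ℂ) ^ 2)⁻¹).re := by
    rw [hq2, Complex.re_mul_ofReal]; positivity
  have hs : Summable fun k : ℤ => (ZMod.stdAddChar (-(p * (k : ZMod q) ^ 2)) : ℂ) *
        Complex.exp (-Real.pi * a * ((k : ℂ) / q) ^ 2) := by
    refine summable_bounded_mul (B := 1) (fun k => (AddChar.norm_apply _ _).le) ?_
    refine ((summable_cexp_neg_pi_mul_mul_sq ha').congr fun k => ?_).norm
    congr 1
    ring
  rw [tsum_int_eq_sum_zmod (q := q) hs]
  have hres : ∀ r : ZMod q, ∀ j : ℤ, ((j * q + r.val : ℤ) : ZMod q) = r := by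
    intro r j; simp
  simp_rw [hres]
  simp_rw [tsum_mul_left, tsum_gaussian_residue_class ha]
  have hs2 : ∀ r ∈ (Finset.univ : Finset (ZMod q)), Summable fun m : ℤ =>
      (ZMod.stdAddChar (-(p * r ^ 2)) : ℂ) * (ZMod.stdAddChar ((m : ZMod q) * r) *
          Complex.exp (-Real.pi / a * m ^ 2)) := by
    intro r _
    refine Summable.mul_left _ ?_
    refine summable_bounded_mul (B := 1) (fun k => (AddChar.norm_apply _ _).le) ?_
    refine ((summable_cexp_neg_pi_mul_mul_sq (div_re_pos ha)).congr fun k => ?_).norm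
    congr 1
    ring
  have hG : ∀ m : ℤ, quadGaussSum p (m : ZMod q) * Complex.exp (-Real.pi / a * m ^ 2)
      = ∑ r : ZMod q, (ZMod.stdAddChar (-(p * r ^ 2)) : ℂ) * (ZMod.stdAddChar ((m : ZMod q) * r) *
          Complex.exp (-Real.pi / a * m ^ 2)) := by
    intro m
    rw [quadGaussSum, Finset.sum_mul]
    refine Finset.sum_congr rfl fun r _ => ?_
    rw [AddChar.map_add_eq_mul, mul_assoc]
  simp_rw [hG]
  rw [Summable.tsum_finsetSum hs2, Finset.mul_sum]
  refine Finset.sum_congr rfl fun r _ => ?_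
  rw [tsum_mul_left]
  ring

/-! ### Oscillatory integrals along a vertical segment -/

/-- The point `ε + is` of the right half-plane, scaled by `L`. -/
noncomputable def vertLine (L ε s : ℝ) : ℂ := L * (ε + Complex.I * s)

theorem vertLine_re (L ε s : ℝ) : (vertLine L ε s).re = L * ε := by
  simp [vertLine]

theorem vertLine_mem_slitPlane {L ε : ℝ} (hL : 0 < L) (hε : 0 < ε) (s : ℝ) :
    vertLine L ε s ∈ Complex.slitPlane :=
  Or.inl (by rw [vertLine_re]; positivity)

theorem vertLine_ne_zero {L ε : ℝ} (hL : 0 < L) (hε : 0 < ε) (s : ℝ) : vertLine L ε s ≠ 0 :=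
  Complex.slitPlane_ne_zero (vertLine_mem_slitPlane hL hε s)

theorem norm_vertLine_le {L ε h s : ℝ} (hL : 0 < L) (hε : 0 < ε) (hεh : ε ≤ |h|) (hs : |s| ≤ |h|) :
    ‖vertLine L ε s‖ ≤ 2 * L * |h| := by
  rw [vertLine, norm_mul, Complex.norm_real, Real.norm_of_nonneg hL.le]
  have : ‖(ε : ℂ) + Complex.I * s‖ ≤ ε + |s| := by
    refine (norm_add_le _ _).trans ?_
    simp [abs_of_pos hε]
  nlinarith

theorem hasDerivAt_vertLine (L ε s : ℝ) :
    HasDerivAt (vertLine L ε) (L * Complex.I) s := by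
  have h1 : HasDerivAt (fun s : ℝ => (s : ℂ)) 1 s := Complex.ofRealCLM.hasDerivAt
  simpa [vertLine] using! ((h1.const_mul Complex.I).const_add (ε : ℂ)).const_mul (L : ℂ)

theorem continuous_vertLine (L ε : ℝ) : Continuous (vertLine L ε) := by
  unfold vertLine; fun_prop

theorem norm_cexp_neg_div_le_one {c : ℝ} (hc : 0 ≤ c) {w : ℂ} (hw : 0 < w.re) :
    ‖Complex.exp (-c / w)‖ ≤ 1 := by
  rw [Complex.norm_exp, Real.exp_le_one_iff]
  have : (-c / w : ℂ) = ((-c : ℝ) : ℂ) * (1 / w) := by push_cast; ring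
  rw [this, Complex.re_ofReal_mul]
  have := div_re_pos hw
  nlinarith

theorem continuous_vertLine_cpow_mul_cexp {L ε : ℝ} (hL : 0 < L) (hε : 0 < ε) (c : ℝ) (e : ℂ) :
    Continuous fun s => vertLine L ε s ^ e * Complex.exp (-c / vertLine L ε s) :=
  ((continuous_vertLine L ε).cpow continuous_const (vertLine_mem_slitPlane hL hε)).mul
    (Complex.continuous_exp.comp (continuous_const.div (continuous_vertLine L ε)
      (vertLine_ne_zero hL hε)))

theorem hasDerivAt_vertLine_cpow_mul_cexp {L ε : ℝ} (hL : 0 < L) (hε : 0 < ε) (c s : ℝ) :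
    HasDerivAt (fun s => vertLine L ε s ^ (3 / 2 : ℂ) * Complex.exp (-c / vertLine L ε s))
      (L * Complex.I * (3 / 2 * (vertLine L ε s ^ (1 / 2 : ℂ) *
          Complex.exp (-c / vertLine L ε s))
        + c * (vertLine L ε s ^ (-1 / 2 : ℂ) * Complex.exp (-c / vertLine L ε s)))) s := by
  have hw := vertLine_ne_zero hL hε s
  have h1 := ((hasDerivAt_id (vertLine L ε s)).cpow_const (c := 3 / 2)
    (vertLine_mem_slitPlane hL hε s)).comp s (hasDerivAt_vertLine L ε s)
  have h2 := (((hasDerivAt_vertLine L ε s).inv hw).const_mul (-c : ℂ)).cexp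
  have h3 := h1.mul h2
  have e1 : vertLine L ε s ^ (3 / 2 : ℂ) = vertLine L ε s ^ (-1 / 2 : ℂ) * vertLine L ε s ^ 2 := by
    rw [← Complex.cpow_natCast, ← Complex.cpow_add _ _ hw]; norm_num
  refine (h3.congr_deriv ?_)
  simp only [Function.comp_apply, id, Pi.inv_apply, ← div_eq_mul_inv]
  rw [e1]
  have e2 : (3 / 2 - 1 : ℂ) = 1 / 2 := by norm_num
  rw [e2]
  field_simp

theorem abs_le_of_mem_uIoc_zero {h s : ℝ} (hs : s ∈ Set.uIoc 0 h) : |s| ≤ |h| := by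
  rcases le_total 0 h with h0 | h0
  · rw [Set.uIoc_of_le h0] at hs
    rw [abs_of_pos hs.1, abs_of_nonneg h0]; exact hs.2
  · rw [Set.uIoc_of_ge h0] at hs
    rw [abs_of_nonpos hs.2, abs_of_nonpos h0]; linarith [hs.1]

/-- The integrand oscillates with phase `c / (L s)`. Integrating by parts against
`d(exp (-c / w)) = c w⁻² exp (-c / w) dw` gains the factor `1 / c`, uniformly in the distance `ε`
to the boundary of the half-plane. -/
theorem norm_integral_vertLine_le {L ε h c : ℝ} (hL : 0 < L) (hε : 0 < ε) (hεh : ε ≤ |h|)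
    (hc : 0 < c) :
    ‖∫ s in (0 : ℝ)..h, vertLine L ε s ^ (-1 / 2 : ℂ) * Complex.exp (-c / vertLine L ε s)‖
      ≤ 3 * (2 * L * |h|) ^ (3 / 2 : ℝ) / (L * c) := by
  set R := 2 * L * |h| with hR
  have hR0 : 0 ≤ R := by positivity
  have hbd : ∀ (e : ℝ), 0 ≤ e → ∀ s : ℝ, |s| ≤ |h| →
      ‖vertLine L ε s ^ (e : ℂ) * Complex.exp (-c / vertLine L ε s)‖ ≤ R ^ e := by
    intro e he s hs
    rw [norm_mul, Complex.norm_cpow_real]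
    have h1 := norm_cexp_neg_div_le_one hc.le (w := vertLine L ε s)
      (by rw [vertLine_re]; positivity)
    have h2 : ‖vertLine L ε s‖ ^ e ≤ R ^ e :=
      Real.rpow_le_rpow (norm_nonneg _) (norm_vertLine_le hL hε hεh hs) he
    calc _ ≤ R ^ e * 1 := mul_le_mul h2 h1 (norm_nonneg _) (by positivity)
      _ = _ := mul_one _
  have hc1 := continuous_vertLine_cpow_mul_cexp hL hε c (1 / 2)
  have hc2 := continuous_vertLine_cpow_mul_cexp hL hε c (-1 / 2)
  have hftc := intervalIntegral.integral_eq_sub_of_hasDerivAt (a := 0) (b := h)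
    (fun s _ => hasDerivAt_vertLine_cpow_mul_cexp hL hε c s)
    (Continuous.intervalIntegrable (by fun_prop) _ _)
  rw [intervalIntegral.integral_const_mul, intervalIntegral.integral_add
    ((hc1.const_mul _).intervalIntegrable _ _) ((hc2.const_mul _).intervalIntegrable _ _),
    intervalIntegral.integral_const_mul, intervalIntegral.integral_const_mul] at hftc
  set J := ∫ s in (0 : ℝ)..h, vertLine L ε s ^ (-1 / 2 : ℂ) * Complex.exp (-c / vertLine L ε s)
  have hI : ‖∫ s in (0 : ℝ)..h, vertLine L ε s ^ (1 / 2 : ℂ) *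
      Complex.exp (-c / vertLine L ε s)‖ ≤ R ^ (1 / 2 : ℝ) * |h| := by
    have := intervalIntegral.norm_integral_le_of_norm_le_const (a := 0) (b := h)
      (f := fun s => vertLine L ε s ^ (1 / 2 : ℂ) * Complex.exp (-c / vertLine L ε s))
      (C := R ^ (1 / 2 : ℝ)) (fun s hs => by
        simpa using hbd (1 / 2) (by norm_num) s (abs_le_of_mem_uIoc_zero hs))
    simpa using this
  set I₁ := ∫ s in (0 : ℝ)..h, vertLine L ε s ^ (1 / 2 : ℂ) * Complex.exp (-c / vertLine L ε s)
  have hF1 := hbd (3 / 2) (by norm_num) h le_rfl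
  have hF0 := hbd (3 / 2) (by norm_num) 0 (by simp)
  push_cast at hF1 hF0
  set F1 := vertLine L ε h ^ (3 / 2 : ℂ) * Complex.exp (-c / vertLine L ε h)
  set F0 := vertLine L ε 0 ^ (3 / 2 : ℂ) * Complex.exp (-c / vertLine L ε 0)
  have hJ : ((L * c : ℝ) : ℂ) * Complex.I * J
      = F1 - F0 - ((3 / 2 * L : ℝ) : ℂ) * Complex.I * I₁ := by
    push_cast
    linear_combination hftc
  have hRR : R ^ (3 / 2 : ℝ) = R * R ^ (1 / 2 : ℝ) := by
    rw [← Real.rpow_one_add' hR0 (by norm_num)]; norm_num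
  have hn : L * c * ‖J‖ ≤ R ^ (3 / 2 : ℝ) + R ^ (3 / 2 : ℝ)
      + 3 / 2 * L * (R ^ (1 / 2 : ℝ) * |h|) := by
    have e1 : L * c * ‖J‖ = ‖((L * c : ℝ) : ℂ) * Complex.I * J‖ := by
      rw [norm_mul, norm_mul, Complex.norm_real, Complex.norm_I, mul_one,
        Real.norm_of_nonneg (by positivity)]
    rw [e1, hJ]
    refine (norm_sub_le _ _).trans (add_le_add ((norm_sub_le _ _).trans (add_le_add hF1 hF0)) ?_)
    rw [norm_mul, norm_mul, Complex.norm_real, Complex.norm_I, mul_one,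
      Real.norm_of_nonneg (by positivity)]
    gcongr
  rw [le_div_iff₀ (by positivity)]
  have : 3 / 2 * L * (R ^ (1 / 2 : ℝ) * |h|) = 3 / 4 * R ^ (3 / 2 : ℝ) := by rw [hRR, hR]; ring
  have : 0 ≤ R ^ (3 / 2 : ℝ) := by positivity
  linarith [mul_comm (L * c) ‖J‖]

/-! ### The regularised increment of Riemann's function -/

/-- The Gaussian factor makes the series for the derivative of `riemannPhi` converge, so that it
may be integrated term by term. -/
theorem integral_cexp_vertLine (ε h : ℝ) (k : ℤ) :
    ∫ s in (0 : ℝ)..h, Complex.exp (-4 * Real.pi ^ 2 * (ε + Complex.I * s) * k ^ 2)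
      = -Complex.I * (Real.exp (-4 * Real.pi ^ 2 * ε * k ^ 2) * riemannTerm h k) := by
  by_cases hk : k = 0
  · subst hk
    simp only [riemannTerm, if_true, Int.cast_zero]
    simp [← mul_assoc]
  · have hk' : (k : ℂ) ≠ 0 := Int.cast_ne_zero.2 hk
    have hpi : (Real.pi : ℂ) ≠ 0 := Complex.ofReal_ne_zero.2 Real.pi_ne_zero
    have hsplit : ∀ s : ℝ, Complex.exp (-4 * Real.pi ^ 2 * (ε + Complex.I * s) * k ^ 2)
        = Complex.exp (-4 * Real.pi ^ 2 * ε * k ^ 2) *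
          Complex.exp ((-4 * Real.pi ^ 2 * Complex.I * k ^ 2) * s) := by
      intro s; rw [← Complex.exp_add]; congr 1; ring
    simp_rw [hsplit]
    rw [intervalIntegral.integral_const_mul, integral_exp_mul_complex (by simp [hk', hpi]),
      riemannTerm, if_neg hk]
    push_cast
    rw [mul_zero, Complex.exp_zero]
    field_simp
    rw [Complex.I_sq]
    ring

/-- Exchange of the integral over the vertical segment with the series on the dual side. It is
legitimate for `ε > 0` because the Gaussians decay uniformly on the segment. -/
theorem hasSum_integral_vertLine {c : ℤ → ℂ} {B : ℝ} (hB : ∀ m, ‖c m‖ ≤ B)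
    {L ε : ℝ} (hL : 0 < L) (hε : 0 < ε) (h : ℝ) :
    HasSum (fun m : ℤ => ∫ s in (0 : ℝ)..h, 1 / vertLine L ε s ^ (1 / 2 : ℂ) *
        (c m * Complex.exp (-Real.pi / vertLine L ε s * m ^ 2)))
      (∫ s in (0 : ℝ)..h, 1 / vertLine L ε s ^ (1 / 2 : ℂ) *
        ∑' m : ℤ, c m * Complex.exp (-Real.pi / vertLine L ε s * m ^ 2)) := by
  have hB0 : 0 ≤ B := (norm_nonneg _).trans (hB 0)
  have hre : ∀ s, 0 < (vertLine L ε s).re := fun s => by rw [vertLine_re]; positivity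
  have hcont : ∀ m : ℤ, Continuous fun s => 1 / vertLine L ε s ^ (1 / 2 : ℂ) *
        (c m * Complex.exp (-Real.pi / vertLine L ε s * m ^ 2)) := by
    intro m
    refine Continuous.mul (continuous_const.div ((continuous_vertLine L ε).cpow continuous_const
      (vertLine_mem_slitPlane hL hε)) fun s => ?_) (continuous_const.mul
        (Complex.continuous_exp.comp ((continuous_const.div (continuous_vertLine L ε)
          (vertLine_ne_zero hL hε)).mul continuous_const)))
    simp [Complex.cpow_eq_zero_iff, vertLine_ne_zero hL hε s]
  have hsum : ∀ s, Summable fun m : ℤ => c m * Complex.exp (-Real.pi / vertLine L ε s * m ^ 2) := by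
    intro s
    refine summable_bounded_mul hB
      ((summable_cexp_neg_pi_mul_mul_sq (div_re_pos (hre s))).congr fun k => ?_).norm
    congr 1
    ring
  -- `re (1 / w) = L ε / |w|²` is continuous and positive, hence bounded below on the segment
  obtain ⟨δ, hδ, hδs⟩ : ∃ δ > 0, ∀ s ∈ Set.uIcc 0 h, δ ≤ (1 / vertLine L ε s).re := by
    obtain ⟨s₀, -, hs₀⟩ := isCompact_uIcc.exists_isMinOn (Set.nonempty_uIcc (a := (0 : ℝ)) (b := h))
      (f := fun s => (1 / vertLine L ε s).re)
      (Complex.continuous_re.comp (continuous_const.div (continuous_vertLine L ε)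
        (vertLine_ne_zero hL hε))).continuousOn
    exact ⟨_, div_re_pos (hre s₀), fun s hs => hs₀ hs⟩
  refine intervalIntegral.hasSum_integral_of_dominated_convergence
    (fun m _ => ((L * ε) ^ (1 / 2 : ℝ))⁻¹ * (B * Real.exp (-Real.pi * δ * (m : ℝ) ^ 2)))
    (fun m => (hcont m).aestronglyMeasurable) (fun m => ?_) ?_ ?_ ?_
  · refine Filter.Eventually.of_forall fun s hs => ?_
    rw [norm_mul, norm_mul, norm_div, norm_one, one_div]
    have h1 : (L * ε) ^ (1 / 2 : ℝ) ≤ ‖vertLine L ε s ^ (1 / 2 : ℂ)‖ := by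
      have := Complex.norm_cpow_real (vertLine L ε s) (1 / 2)
      push_cast at this
      rw [this, ← vertLine_re L ε s]
      exact Real.rpow_le_rpow (hre s).le (Complex.re_le_norm _) (by norm_num)
    have h2 : ‖Complex.exp (-Real.pi / vertLine L ε s * m ^ 2)‖
        ≤ Real.exp (-Real.pi * δ * (m : ℝ) ^ 2) := by
      have := norm_cexp_neg_pi_mul_mul_sq (1 / vertLine L ε s) m
      rw [Complex.ofReal_intCast, mul_one_div] at this
      rw [this, Real.exp_le_exp]
      have h3 := hδs s (Set.uIoc_subset_uIcc hs)
      have h4 : 0 ≤ Real.pi * (m : ℝ) ^ 2 := by positivity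
      nlinarith
    gcongr
    exact hB m
  · exact Filter.Eventually.of_forall fun s _ =>
      ((summable_exp_neg_pi_mul_mul_sq hδ).mul_left _).mul_left _
  · exact intervalIntegrable_const
  · exact Filter.Eventually.of_forall fun s _ => (hsum s).hasSum.mul_left _

theorem norm_cexp_mul_sq (ε s : ℝ) (k : ℤ) :
    ‖Complex.exp (-4 * Real.pi ^ 2 * (ε + Complex.I * s) * k ^ 2)‖
      = Real.exp (-4 * Real.pi ^ 2 * ε * k ^ 2) := by
  have h1 := norm_cexp_neg_pi_mul_mul_sq (vertLine (4 * Real.pi) ε s) k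
  rw [vertLine_re] at h1
  convert h1 using 2
  · congr 1
    rw [vertLine]
    push_cast
    ring
  · ring

theorem summable_exp_mul_sq {ε : ℝ} (hε : 0 < ε) :
    Summable fun k : ℤ => Real.exp (-4 * Real.pi ^ 2 * ε * k ^ 2) := by
  refine (summable_exp_neg_pi_mul_mul_sq (c := 4 * Real.pi * ε) (by positivity)).congr fun k => ?_
  congr 1
  ring

/-- The regularised increment equals the integral of the twisted theta function. -/
theorem tsum_mul_riemannTerm_eq_integral {c : ℤ → ℂ} (hc : ∀ k, ‖c k‖ ≤ 1) {ε : ℝ} (hε : 0 < ε)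
    (h : ℝ) :
    ∑' k : ℤ, c k * (Real.exp (-4 * Real.pi ^ 2 * ε * k ^ 2) * riemannTerm h k)
      = Complex.I * ∫ s in (0 : ℝ)..h,
          ∑' k : ℤ, c k * Complex.exp (-4 * Real.pi ^ 2 * (ε + Complex.I * s) * k ^ 2) := by
  have key : HasSum (fun k : ℤ => ∫ s in (0 : ℝ)..h,
        c k * Complex.exp (-4 * Real.pi ^ 2 * (ε + Complex.I * s) * k ^ 2))
      (∫ s in (0 : ℝ)..h,
        ∑' k : ℤ, c k * Complex.exp (-4 * Real.pi ^ 2 * (ε + Complex.I * s) * k ^ 2)) := by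
    have hb : ∀ (s : ℝ) (k : ℤ),
        ‖c k * Complex.exp (-4 * Real.pi ^ 2 * (ε + Complex.I * s) * k ^ 2)‖
          ≤ Real.exp (-4 * Real.pi ^ 2 * ε * k ^ 2) := by
      intro s k
      rw [norm_mul, norm_cexp_mul_sq]
      exact mul_le_of_le_one_left (Real.exp_pos _).le (hc k)
    refine intervalIntegral.hasSum_integral_of_dominated_convergence
      (fun k _ => Real.exp (-4 * Real.pi ^ 2 * ε * k ^ 2))
      (fun k => Continuous.aestronglyMeasurable (by fun_prop))
      (fun k => Filter.Eventually.of_forall fun s _ => hb s k)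
      (Filter.Eventually.of_forall fun s _ => summable_exp_mul_sq hε)
      intervalIntegrable_const
      (Filter.Eventually.of_forall fun s _ =>
        (Summable.of_norm_bounded (summable_exp_mul_sq hε) (hb s)).hasSum)
  rw [← key.tsum_eq, ← tsum_mul_left]
  refine tsum_congr fun k => ?_
  rw [intervalIntegral.integral_const_mul, integral_cexp_vertLine]
  linear_combination
    (c k * (Real.exp (-4 * Real.pi ^ 2 * ε * k ^ 2) * riemannTerm h k)) * Complex.I_sq

/-- The bound for the regularised increment, uniform in `ε`: in the dual series the term `m = 0` is
absent because its Gauss sum vanishes, and the other terms are `O(q^{3/2} |h|^{3/2} / m²)`. -/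
theorem norm_tsum_regularised_le {q : ℕ} [NeZero q] {p : ZMod q} (hp : IsUnit p)
    (h0 : quadGaussSum p 0 = 0) {ε h : ℝ} (hε : 0 < ε) (hεh : ε ≤ |h|) :
    ‖∑' k : ℤ, ZMod.stdAddChar (-(p * (k : ZMod q) ^ 2)) *
        (Real.exp (-4 * Real.pi ^ 2 * ε * k ^ 2) * riemannTerm h k)‖
      ≤ √(2 * q) * (3 * (2 * (4 * Real.pi * q ^ 2) * |h|) ^ (3 / 2 : ℝ) /
          (4 * Real.pi * q ^ 2 * Real.pi)) * ∑' m : ℤ, 1 / (m : ℝ) ^ 2 := by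
  have hq : (0 : ℝ) < q := Nat.cast_pos.2 (NeZero.pos q)
  have hqc : (q : ℂ) ≠ 0 := Nat.cast_ne_zero.2 (NeZero.ne q)
  -- on `w = L (ε + is)` one has `π w (k / q)² = 4π² (ε + is) k²`
  set L : ℝ := 4 * Real.pi * q ^ 2 with hLdef
  have hL : 0 < L := by positivity
  set K : ℝ := 3 * (2 * L * |h|) ^ (3 / 2 : ℝ) / (L * Real.pi)
  have hK : 0 ≤ K := by positivity
  have htheta : ∀ s : ℝ, ∑' k : ℤ, (ZMod.stdAddChar (-(p * (k : ZMod q) ^ 2)) : ℂ) *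
        Complex.exp (-4 * Real.pi ^ 2 * (ε + Complex.I * s) * k ^ 2)
      = 1 / vertLine L ε s ^ (1 / 2 : ℂ) * ∑' m : ℤ, quadGaussSum p (m : ZMod q) *
          Complex.exp (-Real.pi / vertLine L ε s * m ^ 2) := by
    intro s
    rw [← tsum_stdAddChar_mul_gaussian p (a := vertLine L ε s) (by rw [vertLine_re]; positivity)]
    refine tsum_congr fun k => ?_
    congr 2
    rw [vertLine, hLdef]
    push_cast
    field_simp
  rw [tsum_mul_riemannTerm_eq_integral (fun k => (AddChar.norm_apply _ _).le) hε, norm_mul,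
    Complex.norm_I, one_mul]
  simp_rw [htheta]
  have hsum := hasSum_integral_vertLine (c := fun m : ℤ => quadGaussSum p (m : ZMod q))
    (fun m => norm_quadGaussSum_le hp m) hL hε h
  rw [← hsum.tsum_eq]
  refine tsum_of_norm_bounded ((Real.summable_one_div_int_pow.2 one_lt_two).hasSum.mul_left _) ?_
  intro m
  by_cases hm : m = 0
  · subst hm
    simp [h0]
  have hm2 : (0 : ℝ) < (m : ℝ) ^ 2 := by positivity
  have hint : ∫ s in (0 : ℝ)..h, 1 / vertLine L ε s ^ (1 / 2 : ℂ) *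
        (quadGaussSum p (m : ZMod q) * Complex.exp (-Real.pi / vertLine L ε s * m ^ 2))
      = quadGaussSum p (m : ZMod q) * ∫ s in (0 : ℝ)..h, vertLine L ε s ^ (-1 / 2 : ℂ) *
          Complex.exp (-(Real.pi * (m : ℝ) ^ 2 : ℝ) / vertLine L ε s) := by
    rw [← intervalIntegral.integral_const_mul]
    refine intervalIntegral.integral_congr fun s _ => ?_
    have e1 : (-1 / 2 : ℂ) = -(1 / 2) := by norm_num
    have e2 : (-(Real.pi * (m : ℝ) ^ 2 : ℝ) / vertLine L ε s : ℂ)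
        = -Real.pi / vertLine L ε s * m ^ 2 := by push_cast; ring
    simp only [e1, e2, Complex.cpow_neg]
    ring
  rw [hint, norm_mul, mul_assoc]
  refine mul_le_mul (norm_quadGaussSum_le hp _) ?_ (norm_nonneg _) (Real.sqrt_nonneg _)
  refine (norm_integral_vertLine_le hL hε hεh (by positivity)).trans_eq ?_
  simp only [K]
  field_simp

/-! ### Increments of Riemann's function at rational points -/

/-- The increment of the series at `ratPoint p q` is the increment at `0` twisted by the
`q`-periodic coefficients `e(-p k² / q)`. -/
theorem riemannTerm_ratPoint_add_sub {q : ℕ} [NeZero q] (p : ℕ) (h : ℝ) (k : ℤ) :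
    riemannTerm (ratPoint p q + h) k - riemannTerm (ratPoint p q) k
      = ZMod.stdAddChar (-((p : ZMod q) * (k : ZMod q) ^ 2)) * riemannTerm h k := by
  have hqc : (q : ℂ) ≠ 0 := Nat.cast_ne_zero.2 (NeZero.ne q)
  have hpi : (Real.pi : ℂ) ≠ 0 := Complex.ofReal_ne_zero.2 Real.pi_ne_zero
  by_cases hk : k = 0
  · subst hk
    simp [riemannTerm, mul_add]
  · have h1 : -((p : ZMod q) * (k : ZMod q) ^ 2) = ((-(p * k ^ 2) : ℤ) : ZMod q) := by
      push_cast; rfl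
    have h2 : Complex.exp (2 * Real.pi * Complex.I * ((-(p * k ^ 2) : ℤ) : ℂ) / q)
        = Complex.exp (-4 * Real.pi ^ 2 * Complex.I * k ^ 2 * (ratPoint p q : ℝ)) := by
      congr 1
      rw [ratPoint]
      push_cast
      field_simp
      ring
    have h3 : Complex.exp (-4 * Real.pi ^ 2 * Complex.I * k ^ 2 * ((ratPoint p q + h : ℝ) : ℂ))
        = Complex.exp (-4 * Real.pi ^ 2 * Complex.I * k ^ 2 * (ratPoint p q : ℝ)) *
          Complex.exp (-4 * Real.pi ^ 2 * Complex.I * k ^ 2 * h) := by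
      rw [← Complex.exp_add]; congr 1; push_cast; ring
    rw [h1, ZMod.stdAddChar_coe, h2]
    simp only [riemannTerm, if_neg hk]
    rw [h3]
    ring

theorem norm_riemannPhi_ratPoint_add_sub_le {q : ℕ} [NeZero q] {p : ℕ}
    (hp : IsUnit (p : ZMod q)) (h0 : quadGaussSum (p : ZMod q) 0 = 0) {h : ℝ} (hh : h ≠ 0) :
    ‖riemannPhi (ratPoint p q + h) - riemannPhi (ratPoint p q)‖
      ≤ √(2 * q) * (3 * (2 * (4 * Real.pi * q ^ 2) * |h|) ^ (3 / 2 : ℝ) /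
          (4 * Real.pi * q ^ 2 * Real.pi)) * ∑' m : ℤ, 1 / (m : ℝ) ^ 2 := by
  rw [riemannPhi, riemannPhi, ← (summable_riemannTerm _).tsum_sub (summable_riemannTerm _)]
  simp_rw [riemannTerm_ratPoint_add_sub]
  have hlim : Filter.Tendsto (fun ε : ℝ => ∑' k : ℤ,
        ZMod.stdAddChar (-((p : ZMod q) * (k : ZMod q) ^ 2)) *
          (Real.exp (-4 * Real.pi ^ 2 * ε * k ^ 2) * riemannTerm h k))
      (nhdsWithin 0 (Set.Ioi 0)) (nhds (∑' k : ℤ,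
        ZMod.stdAddChar (-((p : ZMod q) * (k : ZMod q) ^ 2)) * riemannTerm h k)) := by
    refine tendsto_tsum_of_dominated_convergence (summable_riemannTerm h).norm (fun k => ?_) ?_
    · have hc : Continuous fun ε : ℝ => (ZMod.stdAddChar (-((p : ZMod q) * (k : ZMod q) ^ 2)) : ℂ) *
          (Real.exp (-4 * Real.pi ^ 2 * ε * k ^ 2) * riemannTerm h k) := by fun_prop
      have := hc.tendsto 0
      simp only [mul_zero, zero_mul, Real.exp_zero, Complex.ofReal_one, one_mul] at this
      exact this.mono_left nhdsWithin_le_nhds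
    · filter_upwards [self_mem_nhdsWithin] with ε hε k
      have hε : 0 < ε := hε
      rw [norm_mul, AddChar.norm_apply, one_mul, norm_mul, Complex.norm_real,
        Real.norm_of_nonneg (Real.exp_pos _).le]
      refine mul_le_of_le_one_left (norm_nonneg _) (Real.exp_le_one_iff.2 ?_)
      have : 0 ≤ Real.pi ^ 2 * ε * (k : ℝ) ^ 2 := by positivity
      linarith
  refine le_of_tendsto hlim.norm ?_
  filter_upwards [Ioc_mem_nhdsGT (abs_pos.2 hh)] with ε hε
  exact norm_tsum_regularised_le hp h0 hε.1 hε.2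

theorem mainTheorem4 (M : ℝ) (hM : 0 < M) :
    ∃ C : ℝ, 0 < C ∧ ∀ p q : ℕ, Nat.Coprime p q → q % 4 = 2 →
      ∀ h : ℝ, |h| ≤ M / (q : ℝ) ^ 2 →
        ‖riemannPhi (ratPoint p q + h) - riemannPhi (ratPoint p q)‖
          ≤ C * (q : ℝ) ^ (3 / 2 : ℝ) * |h| ^ (3 / 2 : ℝ) := by
  have hs : Summable (fun m : ℤ => 1 / (m : ℝ) ^ 2) :=
    Real.summable_one_div_int_pow.2 one_lt_two
  have hS : 0 < ∑' m : ℤ, 1 / (m : ℝ) ^ 2 :=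
    hs.tsum_pos (fun m => by positivity) 1 (by norm_num)
  refine ⟨√2 * (3 * (8 * Real.pi) ^ (3 / 2 : ℝ) / (4 * Real.pi * Real.pi)) *
    ∑' m : ℤ, 1 / (m : ℝ) ^ 2, by positivity, fun p q hpq hq h _ => ?_⟩
  have hq0 : q ≠ 0 := by rintro rfl; simp at hq
  have : NeZero q := ⟨hq0⟩
  have hqpos : (0 : ℝ) < q := by positivity
  rcases eq_or_ne h 0 with rfl | hh
  · simp
  have hodd : Odd p := by
    have h2 : Nat.Coprime p 2 := hpq.coprime_dvd_right (by omega)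
    exact Nat.coprime_two_right.1 h2
  refine (norm_riemannPhi_ratPoint_add_sub_le ((ZMod.isUnit_iff_coprime p q).2 hpq)
    (quadGaussSum_zero_of_mod_four_eq_two hq hodd) hh).trans_eq ?_
  have e1 : (2 * (4 * Real.pi * (q : ℝ) ^ 2) * |h|) ^ (3 / 2 : ℝ)
      = (8 * Real.pi) ^ (3 / 2 : ℝ) * (q : ℝ) ^ 3 * |h| ^ (3 / 2 : ℝ) := by
    rw [show 2 * (4 * Real.pi * (q : ℝ) ^ 2) * |h| = 8 * Real.pi * (q : ℝ) ^ 2 * |h| by ring,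
      Real.mul_rpow (by positivity) (abs_nonneg h), Real.mul_rpow (by positivity) (by positivity),
      ← Real.rpow_natCast_mul hqpos.le]
    norm_num
  have e2 : (q : ℝ) ^ (3 / 2 : ℝ) = q * √q := by
    rw [Real.sqrt_eq_rpow, ← Real.rpow_one_add' hqpos.le (by norm_num)]; norm_num
  rw [e1, e2, Real.sqrt_mul zero_le_two]
  field_simp
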